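/- Consider the synchronous CONGEST$_B$ model: the network is a connected simple graph on $n \ge 1$ nodes, all nodes start simultaneously and run the same deterministic algorithm, and in each round every node sends to each of its neighbours a (possibly different) message of at most $B$ bits, receives the messages of its neighbours, and performs arbitrary local computation. The nodes have distinct identifiers, which are natural numbers bounded by a polynomial in $n$; initially a node knows only $B$, its own identifier, and its degree (its links being numbered arbitrarily). In the All Pairs Shortest Paths problem, every node $v$ of an unweighted graph must halt with the list of the identifiers of all nodes $w$ of the network, each together with the distance from $v$ to $w$. **Theorem.** For every bandwidth $B \ge 1$ there is a deterministic algorithm for the CONGEST$_B$ model that solves the All Pairs Shortest Paths problem in unweighted graphs in $$O\left(D + \frac{n \log n}{B}\right)$$ rounds, where $n$ is the number of nodes and $D$ the diameter of the network. The algorithm depends only on $B$, and the constant hidden in the $O$-notation depends only on the polynomial that bounds the identifiers (in particular, not on $B$, $n$ or the network). -/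

import Mathlib

namespace Congest

universe u

/-- A network: a connected simple graph whose nodes carry distinct natural-number identifiers.
Every node `v` addresses its incident links by local port numbers `0, …, deg v - 1`; the port
numbering is arbitrary, and the existence of the bijection forces `deg v` to be the degree. -/
structure Network (V : Type u) where
  /-- the communication graph -/
  graph : SimpleGraph V
  connected : graph.Connected
  /-- the identifiers -/
  ident : V → ℕ
  ident_injective : Function.Injective ident
  /-- the degree of each node -/
  deg : V → ℕ
  /-- the local numbering of the links of each node -/
  port : ∀ v, Fin (deg v) ≃ graph.neighborSet v

/-- A message carries at most `B` bits; the empty message means that nothing is sent. -/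
abbrev Message (B : ℕ) : Type := {m : List Bool // m.length ≤ B}

/-- The empty message. -/
def Message.empty (B : ℕ) : Message B := ⟨[], Nat.zero_le B⟩

/-- A deterministic algorithm of the CONGEST model with bandwidth `B`, whose nodes have outputs of
type `O`. All nodes run the same algorithm. Initially a node knows only its degree and its own
identifier (and `B`): it knows neither the number of nodes, nor a bound on the identifiers, nor
the identifiers of its neighbours. Local computation is unrestricted. -/
structure Algorithm (B : ℕ) (O : Type) where
  /-- local states -/
  State : Type
  /-- initial state of a node, from its degree and its identifier -/
  init : (d : ℕ) → (ident : ℕ) → State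
  /-- the message that a node of degree `d` sends through each of its ports -/
  send : (d : ℕ) → State → Fin d → Message B
  /-- the new state of a node of degree `d`, from the messages received through its ports -/
  receive : (d : ℕ) → State → (Fin d → Message B) → State
  /-- the output; a node has halted as soon as this is not `none` -/
  output : State → Option O

namespace Algorithm

variable {V : Type u} {B : ℕ} {O : Type}

/-- What a node of degree `d` in state `s` sends through its ports; halted nodes are silent. -/
def outgoing (A : Algorithm B O) (d : ℕ) (s : A.State) (i : Fin d) : Message B :=
  if (A.output s).isSome then Message.empty B else A.send d s i

/-- The messages that `v` receives in a round that starts with the states `σ`: through port `i`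
comes what the neighbour at the other end of that link sends through its own port towards `v`. -/
def incoming (A : Algorithm B O) (N : Network V) (σ : V → A.State) (v : V)
    (i : Fin (N.deg v)) : Message B :=
  let w := N.port v i
  A.outgoing (N.deg w) (σ w) ((N.port w).symm ⟨v, w.property.symm⟩)

/-- One synchronous round; halted nodes do not change their state any more. -/
def round (A : Algorithm B O) (N : Network V) (σ : V → A.State) (v : V) : A.State :=
  if (A.output (σ v)).isSome then σ v else A.receive (N.deg v) (σ v) (A.incoming N σ v)

/-- The states of all nodes after `t` rounds; all nodes start simultaneously. -/
def run (A : Algorithm B O) (N : Network V) : ℕ → V → A.State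
  | 0 => fun v => A.init (N.deg v) (N.ident v)
  | t + 1 => A.round N (A.run N t)

/-- Within `T` rounds, every node `v` halts with output `sol v`. -/
def ComputesWithin (A : Algorithm B O) (N : Network V) (sol : V → O) (T : ℕ) : Prop :=
  ∀ v, A.output (A.run N T v) = some (sol v)

end Algorithm

/-- The output required of node `v` in the All Pairs Shortest Paths problem: the list, as a finite
set, of the identifiers of all nodes `w`, each with the distance from `v` to `w`. -/
noncomputable def apsp {V : Type u} [Fintype V] (N : Network V) (v : V) : Finset (ℕ × ℕ) :=
  Finset.univ.image fun w => (N.ident w, N.graph.dist v w)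

end Congest

/-! Every node streams, at full bandwidth, the list of nodes it has found, ordered by distance, with
a separator closing each layer. Layer `k + 1` of `v` consists of the entries of its neighbours'
layers `k` that lie in no earlier layer of `v`, and it is complete once all neighbours have closed
layer `k`. By `Describes.extend` the list stays correct whatever prefixes have arrived. A closed
empty layer shows that the whole network is listed.

For the running time, entries are forwarded as soon as they are found, without waiting for the layer
to close. Let `b` bound the length of a code word and let `τ` be about `b / B + 2`. `min_le_sent`
shows by induction on `d` that the layers up to `d` leave `v` at `B` bits per round, up to a delay
of `d * τ` rounds: either `v` is still sending its layers up to `d`, or it has closed layer `d + 1`,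
or some neighbour has not yet shown its layers up to `d`. In the last case `v` lists everything this
neighbour has shown (`Describes.length_le_extend`), which is all it has sent except at most one
unfinished word (`known_bounds`), and the delay makes up for that word.

Altogether `(D + 1) * τ + (D + 2 + n * b) / B + 1` rounds suffice; as `b = O(log n)` and `D + 1 ≤
n`, this is the claimed bound. -/

namespace Congest

/-! ### A self-delimiting code for lists of natural numbers -/

/-- A prefix-free code for natural numbers: every binary digit is announced by `true`. -/
def encode (x : ℕ) : List Bool := (x.bits.flatMap fun b => [true, b]) ++ [false]

/-- The concatenation of the codes of the entries of a list. -/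
def encodeList (L : List ℕ) : List Bool := L.flatMap encode

/-- The number with given binary digits, least significant first. -/
def ofBits (l : List Bool) : ℕ := l.foldr Nat.bit 0

/-- Decodes as many complete code words as possible; `acc` holds the digits of the code word that
is being read. -/
def decodeAux : List Bool → List Bool → List ℕ
  | acc, true :: b :: r => decodeAux (acc ++ [b]) r
  | acc, false :: r => ofBits acc :: decodeAux [] r
  -- A stream may break off between an announcement and its digit; the unfinished word is dropped.
  | _, [true] => []
  | _, [] => []

/-- The numbers whose codes are completely contained in a stream of bits. -/
def decode (m : List Bool) : List ℕ := decodeAux [] m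

theorem ofBits_bits (n : ℕ) : ofBits n.bits = n := by
  induction n using Nat.binaryRec' with
  | zero => simp [ofBits]
  | bit b n h ih =>
    rw [Nat.bits_append_bit n b h]
    simp only [ofBits, List.foldr_cons] at ih ⊢
    rw [ih]

theorem length_encode (x : ℕ) : (encode x).length = 2 * x.size + 1 := by
  rw [← Nat.size_eq_bits_len]
  simp [encode, List.length_flatMap, mul_comm]

theorem decodeAux_word (c acc r : List Bool) :
    decodeAux acc ((c.flatMap fun b => [true, b]) ++ false :: r)
      = ofBits (acc ++ c) :: decodeAux [] r := by
  induction c generalizing acc with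
  | nil => simp [decodeAux]
  | cons b c ih => simp [decodeAux, ih]

theorem decodeAux_take_word (c acc : List Bool) (n : ℕ)
    (h : n < ((c.flatMap fun b => [true, b]) ++ [false]).length) :
    decodeAux acc (((c.flatMap fun b => [true, b]) ++ [false]).take n) = [] := by
  induction c generalizing acc n with
  | nil =>
    obtain rfl : n = 0 := by simpa using h
    simp [decodeAux]
  | cons b c ih =>
    match n with
    | 0 => simp [decodeAux]
    | 1 => simp [decodeAux]
    | n + 2 =>
      have := ih (acc ++ [b]) n (by simp at h ⊢; omega)
      simpa [decodeAux] using this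

theorem decode_encode_append (x : ℕ) (r : List Bool) :
    decode (encode x ++ r) = x :: decode r := by
  have := decodeAux_word x.bits [] r
  simpa [decode, encode, ofBits_bits] using this

/-- Decoding the first `n` bits of an encoded list yields the longest prefix whose code fits. -/
theorem decode_take_encodeList (L : List ℕ) (n : ℕ) :
    decode ((encodeList L).take n) = L ∨
      ∃ x, decode ((encodeList L).take n) ++ [x] <+: L ∧
        n < (encodeList (decode ((encodeList L).take n) ++ [x])).length := by
  induction L generalizing n with
  | nil => simp [encodeList, decode, decodeAux]
  | cons x l ih =>
    have e : encodeList (x :: l) = encode x ++ encodeList l := by simp [encodeList]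
    rcases lt_or_ge n (encode x).length with h | h
    · right
      have h0 : decode ((encodeList (x :: l)).take n) = [] := by
        rw [e, List.take_append_of_le_length h.le]
        exact decodeAux_take_word x.bits [] n h
      refine ⟨x, ?_, ?_⟩
      · rw [h0]; simp
      · rw [h0]; simpa [encodeList] using h
    · have h0 : decode ((encodeList (x :: l)).take n)
          = x :: decode ((encodeList l).take (n - (encode x).length)) := by
        rw [e, List.take_append, List.take_of_length_le h, decode_encode_append]
      rw [h0]
      rcases ih (n - (encode x).length) with h1 | ⟨y, h1, h2⟩
      · left; rw [h1]
      · right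
        refine ⟨y, by simpa using h1, ?_⟩
        have e2 : ∀ l', encodeList (x :: l') = encode x ++ encodeList l' := by simp [encodeList]
        rw [List.cons_append, e2, List.length_append]
        omega

theorem decode_take_encodeList_prefix (L : List ℕ) (n : ℕ) :
    decode ((encodeList L).take n) <+: L := by
  rcases decode_take_encodeList L n with h | ⟨x, h, -⟩
  · rw [h]
  · exact (List.prefix_append _ _).trans h

/-! ### Lists that are divided into layers by zeros -/

/-- The entries of `L` between its zeros number `j` and `j + 1`. -/
def layer : ℕ → List ℕ → List ℕ
  | _, [] => []
  | 0, x :: l => if x = 0 then [] else x :: layer 0 l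
  | j + 1, x :: l => if x = 0 then layer j l else layer (j + 1) l

theorem mem_of_mem_layer {j x : ℕ} {L : List ℕ} (h : x ∈ layer j L) : x ∈ L ∧ x ≠ 0 := by
  induction L generalizing j with
  | nil => simp [layer] at h
  | cons y l ih =>
    cases j with
    | zero =>
      by_cases hy : y = 0
      · simp [layer, hy] at h
      · simp only [layer, hy, if_false, List.mem_cons] at h
        rcases h with rfl | h
        · exact ⟨by simp, hy⟩
        · exact ⟨List.mem_cons_of_mem _ (ih h).1, (ih h).2⟩
    | succ j =>
      by_cases hy : y = 0
      · simp only [layer, hy, if_true] at h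
        exact ⟨List.mem_cons_of_mem _ (ih h).1, (ih h).2⟩
      · simp only [layer, hy, if_false] at h
        exact ⟨List.mem_cons_of_mem _ (ih h).1, (ih h).2⟩

theorem exists_mem_layer {x : ℕ} {L : List ℕ} (h : x ∈ L) (hx : x ≠ 0) :
    ∃ j ≤ L.count 0, x ∈ layer j L := by
  induction L with
  | nil => simp at h
  | cons y l ih =>
    by_cases hy : y = 0
    · subst hy
      obtain ⟨j, hj, hm⟩ := ih (by simpa [hx] using h)
      exact ⟨j + 1, by simpa using hj, by simpa [layer] using hm⟩
    · rw [List.count_cons_of_ne hy]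
      rcases List.mem_cons.1 h with rfl | h
      · exact ⟨0, by simp, by simp [layer, hx]⟩
      · obtain ⟨j, hj, hm⟩ := ih h
        refine ⟨j, hj, ?_⟩
        cases j <;> simp [layer, hy, hm]

theorem layer_append_subset {j x : ℕ} {P : List ℕ} (M : List ℕ) (h : x ∈ layer j P) :
    x ∈ layer j (P ++ M) := by
  induction P generalizing j with
  | nil => simp [layer] at h
  | cons y l ih =>
    cases j with
    | zero =>
      by_cases hy : y = 0
      · simp [layer, hy] at h
      · simp only [layer, hy, if_false, List.mem_cons, List.cons_append] at h ⊢
        exact h.imp id ih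
    | succ j =>
      by_cases hy : y = 0
      · simp only [layer, hy, if_true, List.cons_append] at h ⊢
        exact ih h
      · simp only [layer, hy, if_false, List.cons_append] at h ⊢
        exact ih h

theorem layer_append_of_lt {j : ℕ} {P : List ℕ} (M : List ℕ) (h : j < P.count 0) :
    layer j (P ++ M) = layer j P := by
  induction P generalizing j with
  | nil => simp at h
  | cons y l ih =>
    by_cases hy : y = 0
    · subst hy
      cases j with
      | zero => simp [layer]
      | succ j => simpa [layer] using ih (by simpa using h)
    · rw [List.count_cons_of_ne hy] at h
      cases j <;> simp [layer, hy, ih h]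

theorem layer_mono {j x : ℕ} {P L : List ℕ} (hP : P <+: L) (h : x ∈ layer j P) :
    x ∈ layer j L := by
  obtain ⟨M, rfl⟩ := hP
  exact layer_append_subset M h

theorem layer_eq_of_prefix {j : ℕ} {P L : List ℕ} (hP : P <+: L) (h : j < P.count 0) :
    layer j P = layer j L := by
  obtain ⟨M, rfl⟩ := hP
  exact (layer_append_of_lt M h).symm

/-- The block `C` falls into the layer that is still open, whose index is the number of zeros of
`L`; a final zero only closes it. -/
theorem layer_append_block {C E : List ℕ} (hC : 0 ∉ C) (hE : E = [] ∨ E = [0]) (j : ℕ)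
    (L : List ℕ) :
    layer j (L ++ (C ++ E)) = if j = L.count 0 then layer j L ++ C else layer j L := by
  induction L generalizing j with
  | nil =>
    induction C with
    | nil => cases j <;> rcases hE with rfl | rfl <;> simp [layer]
    | cons y l ih =>
      have hy : y ≠ 0 := by rintro rfl; simp at hC
      have := ih (by simp at hC ⊢; exact hC.2)
      cases j <;> simp_all [layer]
  | cons y l ih =>
    by_cases hy : y = 0
    · subst hy
      cases j with
      | zero => simp [layer]
      | succ j => simpa [layer] using ih j
    · rw [List.count_cons_of_ne hy]
      cases j with
      | zero =>
        have := ih 0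
        simp only [layer, hy, if_false, List.cons_append, this]
        split_ifs <;> simp
      | succ j => simpa [layer, hy] using ih (j + 1)

/-! ### Lengths of codes -/

/-- The nonzero entries of a list. -/
def entries (L : List ℕ) : Finset ℕ := (L.filter (· ≠ 0)).toFinset

theorem mem_entries {x : ℕ} {L : List ℕ} : x ∈ entries L ↔ x ∈ L ∧ x ≠ 0 := by
  simp [entries]

theorem length_encodeList {L : List ℕ} (h : (L.filter (· ≠ 0)).Nodup) :
    (encodeList L).length = L.count 0 + ∑ x ∈ entries L, (encode x).length := by
  rw [entries, List.sum_toFinset _ h]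
  clear h
  induction L with
  | nil => simp [encodeList]
  | cons y l ih =>
    have e : encodeList (y :: l) = encode y ++ encodeList l := by simp [encodeList]
    rw [e, List.length_append, ih]
    by_cases hy : y = 0
    · subst hy; simp [length_encode]; ring
    · simp [hy]; ring

theorem encodeList_append (L M : List ℕ) : encodeList (L ++ M) = encodeList L ++ encodeList M := by
  simp [encodeList]

universe u

/-! ### The algorithm -/

/-- The last completed layer is empty. -/
def Exhausted (L : List ℕ) : Prop := layer (L.count 0 - 1) L = []

instance (L : List ℕ) : Decidable (Exhausted L) := by unfold Exhausted; infer_instance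

/-- The entries of the last but one layers of the lists `Y i`, relative to the current layer of `L`,
that are not yet in `L`. -/
def candidates (d : ℕ) (L : List ℕ) (Y : Fin d → List ℕ) : Finset ℕ :=
  (Finset.univ.biUnion fun i => (layer (L.count 0 - 1) (Y i)).toFinset) \ L.toFinset

/-- Adds to the current layer of `L` everything that the neighbours' lists `Y i` show to belong
there, and completes the layer if all neighbours have completed their preceding layers. -/
noncomputable def extend (d : ℕ) (L : List ℕ) (Y : Fin d → List ℕ) : List ℕ :=
  if Exhausted L then L
  -- New entries are appended even if the layer stays open; the pipelining rests on this.
  else L ++ ((candidates d L Y).toList ++ if ∀ i, L.count 0 ≤ (Y i).count 0 then [0] else [])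

/-- The state of a node. -/
structure NodeState where
  /-- the identifiers (plus one) of the nodes found so far, by increasing distance, with a `0` at
  the end of each layer of nodes at the same distance -/
  own : List ℕ
  /-- the number of bits of the code of `own` that have been sent -/
  sent : ℕ
  /-- the bits received through each of the ports -/
  recv : ℕ → List Bool

/-- The table that is described by a list of layers. -/
def table (L : List ℕ) : Finset (ℕ × ℕ) :=
  (Finset.range (L.count 0)).biUnion fun j => (layer j L).toFinset.image fun x => (x - 1, j)

/-- Every node streams the code of the list of its layers, as far as it is known, and finds its
next layer from the preceding layers of its neighbours. -/
noncomputable def layerStreaming (B : ℕ) : Algorithm B (Finset (ℕ × ℕ)) where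
  State := NodeState
  init d a :=
    -- Degree zero means a single node, which must halt at once: the claimed bound is then `0`.
    if d = 0 then ⟨[a + 1, 0, 0], (encodeList [a + 1, 0, 0]).length, fun _ => []⟩
    else ⟨[a + 1, 0], 0, fun _ => []⟩
  send _ s _ := ⟨((encodeList s.own).drop s.sent).take B, by simp⟩
  receive d s m :=
    let recv : ℕ → List Bool := fun i => s.recv i ++ if h : i < d then (m ⟨i, h⟩).val else []
    ⟨extend d s.own fun i => decode (recv i),
      -- The length is that of the list before its extension, from which `send` took its bits.
      min (s.sent + B) (encodeList s.own).length, recv⟩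
  output s :=
    if Exhausted s.own ∧ s.sent = (encodeList s.own).length then some (table s.own) else none

/-! ### Correctness of the lists -/

section

variable {V : Type u} (N : Network V)

theorem Network.dist_le_add_one {v w : V} (h : N.graph.Adj v w) (s : V) :
    N.graph.dist v s ≤ N.graph.dist w s + 1 := by
  have := N.connected.dist_triangle (u := v) (v := w) (w := s)
  rw [SimpleGraph.dist_eq_one_iff_adj.2 h] at this
  omega

theorem Network.exists_adj_dist {v s : V} {k : ℕ} (h : N.graph.dist v s = k + 1) :
    ∃ w, N.graph.Adj v w ∧ N.graph.dist w s = k := by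
  obtain ⟨p, hp⟩ := N.connected.exists_walk_length_eq_dist v s
  cases p with
  | nil => simp at h
  | cons hadj q =>
    rename_i w
    refine ⟨w, hadj, ?_⟩
    have h1 := SimpleGraph.dist_le q
    have h2 := N.dist_le_add_one hadj s
    simp at hp
    omega

theorem Network.exists_dist_eq {v s : V} {j : ℕ} (h : j ≤ N.graph.dist v s) :
    ∃ r, N.graph.dist v r = j := by
  obtain ⟨m, hm⟩ := Nat.exists_eq_add_of_le h
  induction m generalizing s with
  | zero => exact ⟨s, by omega⟩
  | succ m ih =>
    obtain ⟨w, -, hw⟩ := N.exists_adj_dist (v := s) (s := v) (k := j + m)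
      (by rw [SimpleGraph.dist_comm]; omega)
    rw [SimpleGraph.dist_comm] at hw
    exact ih (by omega) hw

theorem Network.exists_port {v w : V} (h : N.graph.Adj v w) : ∃ i, (N.port v i : V) = w :=
  ⟨(N.port v).symm ⟨w, h⟩, by simp⟩

/-- `L` correctly describes the nodes around `v`, in layers by distance. -/
structure Describes (v : V) (L : List ℕ) : Prop where
  sound : ∀ j x, x ∈ layer j L → ∃ s, x = N.ident s + 1 ∧ N.graph.dist v s = j
  complete : ∀ j < L.count 0, ∀ s, N.graph.dist v s = j → N.ident s + 1 ∈ layer j L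
  nodup : (L.filter (· ≠ 0)).Nodup
  -- Only the last closed layer may be empty, because exhausted lists stop growing.
  nonempty : ∀ j, j + 2 ≤ L.count 0 → ∃ s, N.graph.dist v s = j
  pos : 0 < L.count 0

variable {N}

theorem describes_init (v : V) : Describes N v [N.ident v + 1, 0] := by
  refine ⟨?_, ?_, by simp, by simp, by simp⟩
  · intro j x hx
    match j with
    | 0 =>
      simp [layer] at hx
      exact ⟨v, hx, by simp⟩
    | 1 => simp [layer] at hx
    | j + 2 => simp [layer] at hx
  · intro j hj s hs
    obtain rfl : j = 0 := by simpa using hj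
    obtain rfl : v = s := (N.connected.dist_eq_zero_iff).1 hs
    simp [layer]

theorem Describes.mem_layer {v : V} {L : List ℕ} (h : Describes N v L) {s : V}
    (hs : N.ident s + 1 ∈ L) : N.ident s + 1 ∈ layer (N.graph.dist v s) L := by
  obtain ⟨j, -, hm⟩ := exists_mem_layer hs (by omega)
  obtain ⟨r, hr, hd⟩ := h.sound j _ hm
  obtain rfl : s = r := N.ident_injective (by omega)
  rwa [hd]

/-- The distances from `v` have no gaps, so an empty closed layer bounds them all. -/
theorem Describes.dist_lt {v : V} {L : List ℕ} (h : Describes N v L) (hE : Exhausted L) (s : V) :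
    N.graph.dist v s < L.count 0 - 1 := by
  by_contra hs
  obtain ⟨r, hr⟩ := N.exists_dist_eq (not_lt.1 hs)
  have := h.complete _ (by have := h.pos; omega) r hr
  rw [hE] at this
  simp at this

theorem zero_notMem_candidates (d : ℕ) (L : List ℕ) (Y : Fin d → List ℕ) :
    0 ∉ (candidates d L Y).toList := by
  simp only [candidates, Finset.mem_toList, Finset.mem_sdiff, Finset.mem_biUnion, not_and]
  rintro ⟨i, -, hi⟩
  exact absurd rfl (mem_of_mem_layer (List.mem_toFinset.1 hi)).2

theorem mem_candidates {d : ℕ} {L : List ℕ} {Y : Fin d → List ℕ} {x : ℕ} :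
    x ∈ candidates d L Y ↔ (∃ i, x ∈ layer (L.count 0 - 1) (Y i)) ∧ x ∉ L := by
  simp [candidates]

theorem prefix_extend (d : ℕ) (L : List ℕ) (Y : Fin d → List ℕ) : L <+: extend d L Y := by
  unfold extend
  split_ifs <;> simp

theorem count_extend {d : ℕ} {L : List ℕ} {Y : Fin d → List ℕ} (hE : ¬ Exhausted L) :
    (extend d L Y).count 0 = L.count 0 + if ∀ i, L.count 0 ≤ (Y i).count 0 then 1 else 0 := by
  have := List.count_eq_zero_of_not_mem (zero_notMem_candidates d L Y)
  simp only [extend, hE, if_false, List.count_append, this]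
  split_ifs <;> simp

theorem layer_extend {d : ℕ} {L : List ℕ} {Y : Fin d → List ℕ} (hE : ¬ Exhausted L) (j : ℕ) :
    layer j (extend d L Y)
      = if j = L.count 0 then layer j L ++ (candidates d L Y).toList else layer j L := by
  simp only [extend, hE, if_false]
  exact layer_append_block (zero_notMem_candidates d L Y) (by split_ifs <;> simp) j L

theorem Describes.extend {v : V} {L : List ℕ} (h : Describes N v L)
    {Y M : Fin (N.deg v) → List ℕ} (hM : ∀ i, Describes N (N.port v i : V) (M i))
    (hY : ∀ i, Y i <+: M i) : Describes N v (extend (N.deg v) L Y) := by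
  by_cases hE : Exhausted L
  · simpa [Congest.extend, hE] using h
  have hadj : ∀ i, N.graph.Adj v (N.port v i) := fun i => (N.port v i).2
  have hpos := h.pos
  have hcand : ∀ x ∈ candidates (N.deg v) L Y,
      ∃ s, x = N.ident s + 1 ∧ N.graph.dist v s = L.count 0 := by
    intro x hx
    obtain ⟨⟨i, hi⟩, hxL⟩ := mem_candidates.1 hx
    obtain ⟨s, rfl, hs⟩ := (hM i).sound _ _ (layer_mono (hY i) hi)
    refine ⟨s, rfl, ?_⟩
    have h1 := N.dist_le_add_one (hadj i) s
    -- The distance is at most `L.count 0`; a smaller one would put `s` in a closed layer, hence in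
    -- `L`.
    by_contra hne
    exact hxL (mem_of_mem_layer (h.complete _ (by omega) s rfl)).1
  refine ⟨?_, ?_, ?_, ?_, ?_⟩
  · intro j x hx
    rw [layer_extend hE] at hx
    split_ifs at hx with hj
    · rcases List.mem_append.1 hx with hx1 | hx1
      · exact h.sound _ _ hx1
      · subst hj
        exact hcand x (Finset.mem_toList.1 hx1)
    · exact h.sound _ _ hx
  · intro j hj s hs
    rw [count_extend hE] at hj
    rw [layer_extend hE]
    split_ifs at hj with hall
    · rcases Nat.lt_or_ge j (L.count 0) with hjk | hjk
      · rw [if_neg hjk.ne]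
        exact h.complete j hjk s hs
      · obtain rfl : j = L.count 0 := by omega
        rw [if_pos rfl, List.mem_append]
        by_cases hxL : N.ident s + 1 ∈ L
        · left
          rw [← hs]
          exact h.mem_layer hxL
        · right
          obtain ⟨w, hw, hd⟩ := N.exists_adj_dist (v := v) (s := s) (k := L.count 0 - 1) (by omega)
          obtain ⟨i, rfl⟩ := N.exists_port hw
          rw [Finset.mem_toList, mem_candidates]
          refine ⟨⟨i, ?_⟩, hxL⟩
          have hi := hall i
          rw [layer_eq_of_prefix (hY i) (by omega)]
          refine (hM i).complete _ ?_ s hd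
          have := (hY i).sublist.count_le 0
          omega
    · rw [if_neg (by omega)]
      exact h.complete j (by omega) s hs
  · simp only [Congest.extend, hE, if_false, List.filter_append]
    have h2 : (if ∀ i, L.count 0 ≤ (Y i).count 0 then [0] else []).filter (· ≠ 0) = [] := by
      split_ifs <;> simp
    rw [h2, List.append_nil]
    refine List.Nodup.append h.nodup ((Finset.nodup_toList _).filter _) ?_
    intro x hx hx'
    have h3 := (mem_candidates.1 (Finset.mem_toList.1 (List.mem_filter.1 hx').1)).2
    exact h3 (List.mem_filter.1 hx).1
  · intro j hj
    rw [count_extend hE] at hj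
    by_cases hjk : j + 2 ≤ L.count 0
    · exact h.nonempty j hjk
    · obtain rfl : j = L.count 0 - 1 := by split_ifs at hj <;> omega
      obtain ⟨x, hx⟩ := List.exists_mem_of_ne_nil _ hE
      obtain ⟨s, -, hs⟩ := h.sound _ _ hx
      exact ⟨s, hs⟩
  · rw [count_extend hE]
    omega

theorem Describes.table_eq [Fintype V] {v : V} {L : List ℕ} (h : Describes N v L)
    (hE : Exhausted L) : table L = apsp N v := by
  ext ⟨a, j⟩
  simp only [table, apsp, Finset.mem_biUnion, Finset.mem_range, Finset.mem_image,
    List.mem_toFinset, Finset.mem_univ, true_and, Prod.mk.injEq]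
  constructor
  · rintro ⟨j, -, x, hx, rfl, rfl⟩
    obtain ⟨s, rfl, hs⟩ := h.sound _ _ hx
    exact ⟨s, by simp, hs⟩
  · rintro ⟨s, rfl, rfl⟩
    have := h.dist_lt hE s
    exact ⟨_, by omega, _, h.complete _ (by omega) s rfl, by simp, rfl⟩

end

variable {V : Type u} {N : Network V}

/-! ### Code lengths of balls -/

section weight

variable [Fintype V]

/-- The identifiers (plus one) of the nodes within distance `d` of `v`. -/
noncomputable def ballEntries (N : Network V) (d : ℕ) (v : V) : Finset ℕ :=
  (Finset.univ.filter fun s => N.graph.dist v s ≤ d).image fun s => N.ident s + 1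

/-- The length of the code of the layers `0, …, d` around `v`. -/
noncomputable def ballLength (N : Network V) (d : ℕ) (v : V) : ℕ :=
  d + 1 + ∑ x ∈ ballEntries N d v, (encode x).length

theorem Describes.entries_subset {v : V} {L P : List ℕ} (h : Describes N v L) (hP : P <+: L)
    {d : ℕ} (hd : P.count 0 ≤ d) : entries P ⊆ ballEntries N d v := by
  intro x hx
  obtain ⟨hx, hx0⟩ := mem_entries.1 hx
  obtain ⟨j, hj, hm⟩ := exists_mem_layer hx hx0
  obtain ⟨s, rfl, hs⟩ := h.sound _ _ (layer_mono hP hm)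
  simp only [ballEntries, Finset.mem_image, Finset.mem_filter, Finset.mem_univ, true_and]
  exact ⟨s, by omega, rfl⟩

omit [Fintype V] in
theorem Describes.nodup_prefix {v : V} {L P : List ℕ} (h : Describes N v L) (hP : P <+: L) :
    (P.filter (· ≠ 0)).Nodup :=
  h.nodup.sublist (hP.sublist.filter _)

theorem Describes.length_lt {v : V} {L P : List ℕ} (h : Describes N v L) (hP : P <+: L)
    {d : ℕ} (hd : P.count 0 ≤ d) : (encodeList P).length < ballLength N d v := by
  rw [length_encodeList (h.nodup_prefix hP), ballLength]
  have := Finset.sum_le_sum_of_subset (f := fun x => (encode x).length) (h.entries_subset hP hd)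
  omega

/-- A separator costs one bit, for which the strict inequality of `Describes.length_lt` leaves room;
any other entry adds no zero. -/
theorem Describes.length_append_singleton_le {v : V} {x : ℕ} {L P : List ℕ} (h : Describes N v L)
    (hP : P ++ [x] <+: L) {d : ℕ} (hd : P.count 0 ≤ d) :
    (encodeList (P ++ [x])).length ≤ ballLength N d v := by
  by_cases hx : x = 0
  · have := h.length_lt ((List.prefix_append P [x]).trans hP) hd
    rw [encodeList_append, List.length_append]
    have h0 : (encodeList [x]).length = 1 := by simp [hx, encodeList, length_encode]
    omega
  · refine (h.length_lt hP ?_).le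
    rw [List.count_append, List.count_singleton]
    simpa [hx] using hd

theorem Describes.ballLength_le {v : V} {L : List ℕ} (h : Describes N v L) {d : ℕ}
    (hd : d < L.count 0) : ballLength N d v ≤ (encodeList L).length := by
  rw [length_encodeList h.nodup, ballLength]
  have : ballEntries N d v ⊆ entries L := by
    intro x hx
    simp only [ballEntries, Finset.mem_image, Finset.mem_filter, Finset.mem_univ, true_and] at hx
    obtain ⟨s, hs, rfl⟩ := hx
    exact mem_entries.2 (mem_of_mem_layer (h.complete _ (by omega) s rfl))
  have := Finset.sum_le_sum_of_subset (f := fun x => (encode x).length) this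
  omega

theorem Describes.lt_count {v : V} {L : List ℕ} (h : Describes N v L) {d n : ℕ}
    (hn : ballLength N d v ≤ n) (hL : n ≤ (encodeList L).length) : d < L.count 0 := by
  by_contra hd
  have := h.length_lt (List.prefix_refl L) (not_lt.1 hd)
  omega

end weight

/-! ### Progress in a single round -/

/-- Because of `r`, an exhausted list already has enough layers. Otherwise the critical case is
`L.count 0 = d + 1`, where `hY` lets the open layer close. -/
theorem Describes.lt_count_extend {v : V} {L : List ℕ} (h : Describes N v L) {d : ℕ}
    (hd : d < L.count 0) {r : V} (hr : d ≤ N.graph.dist v r) {Y : Fin (N.deg v) → List ℕ}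
    (hY : ∀ i, d < (Y i).count 0) : d + 1 < (Congest.extend (N.deg v) L Y).count 0 := by
  by_cases hE : Exhausted L
  · have := h.dist_lt hE r
    simp only [Congest.extend, hE, if_true]
    omega
  · rw [count_extend hE]
    by_cases hk : L.count 0 = d + 1
    · rw [if_pos fun i => by have := hY i; omega]
      omega
    · omega

/-- Entries of `Y i` are within `d` of the neighbour, hence within `d + 1` of `v`: they lie in a
closed layer of `L`, or belong to its open layer and are in `L` or among the candidates. -/
theorem Describes.length_le_extend {v : V} {L : List ℕ} (h : Describes N v L) {d : ℕ}
    (hd : d < L.count 0) {Y M : Fin (N.deg v) → List ℕ}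
    (hM : ∀ i, Describes N (N.port v i : V) (M i)) (hY : ∀ i, Y i <+: M i)
    {i : Fin (N.deg v)} (hi : (Y i).count 0 ≤ d) :
    (encodeList (Y i)).length ≤ (encodeList (Congest.extend (N.deg v) L Y)).length := by
  have h' := h.extend hM hY
  rw [length_encodeList h'.nodup,
    length_encodeList ((hM i).nodup.sublist ((hY i).sublist.filter _))]
  have hc := (prefix_extend (N.deg v) L Y).sublist.count_le 0
  have : entries (Y i) ⊆ entries (Congest.extend (N.deg v) L Y) := by
    intro x hx
    obtain ⟨hx, hx0⟩ := mem_entries.1 hx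
    refine mem_entries.2 ⟨?_, hx0⟩
    obtain ⟨j, hj, hm⟩ := exists_mem_layer hx hx0
    obtain ⟨s, rfl, hs⟩ := (hM i).sound _ _ (layer_mono (hY i) hm)
    have h1 := N.dist_le_add_one (N.port v i).2 s
    by_cases hk : N.graph.dist v s < L.count 0
    · exact (prefix_extend _ _ _).subset (mem_of_mem_layer (h.complete _ hk s rfl)).1
    · have hE : ¬ Exhausted L := by
        intro hE
        have := h.dist_lt hE s
        omega
      by_cases hsL : N.ident s + 1 ∈ L
      · exact (prefix_extend _ _ _).subset hsL
      · have : N.ident s + 1 ∈ candidates (N.deg v) L Y := by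
          refine mem_candidates.2 ⟨⟨i, ?_⟩, hsL⟩
          obtain rfl : j = L.count 0 - 1 := by omega
          exact hm
        simp [Congest.extend, hE, this]
  have := Finset.sum_le_sum_of_subset (f := fun x => (encode x).length) this
  omega

/-! ### The run of the algorithm -/

/-- The state of node `v` after `t` rounds. -/
noncomputable def stateAt (B : ℕ) (N : Network V) (t : ℕ) (v : V) : NodeState :=
  (layerStreaming B).run N t v

/-- What neighbours of `v` know of its list after `t` rounds. -/
noncomputable def knownAt (B : ℕ) (N : Network V) (t : ℕ) (v : V) : List ℕ :=
  decode ((encodeList (stateAt B N t v).own).take (stateAt B N t v).sent)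

/-- The halting condition. -/
def NodeState.Halted (s : NodeState) : Prop :=
  Exhausted s.own ∧ s.sent = (encodeList s.own).length

theorem output_eq (B : ℕ) (s : NodeState) [Decidable s.Halted] :
    (layerStreaming B).output s = if s.Halted then some (table s.own) else none := by
  unfold NodeState.Halted layerStreaming
  simp only
  congr

theorem val_outgoing (B d : ℕ) (s : NodeState) (i : Fin d) :
    ((layerStreaming B).outgoing d s i).val = ((encodeList s.own).drop s.sent).take B := by
  classical
  have h := output_eq B s
  unfold Algorithm.outgoing
  by_cases hs : s.Halted
  · rw [if_pos hs] at h
    rw [h]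
    simp [Message.empty, hs.2]
  · rw [if_neg hs] at h
    rw [h]
    rfl

theorem stateAt_succ_of_halted {B t : ℕ} {v : V} (h : (stateAt B N t v).Halted) :
    stateAt B N (t + 1) v = stateAt B N t v := by
  classical
  have : (layerStreaming B).output ((layerStreaming B).run N t v) = _ := output_eq B (stateAt B N t v)
  rw [if_pos h] at this
  change (layerStreaming B).round N _ v = _
  rw [Algorithm.round, this]
  rfl

theorem stateAt_succ_of_not_halted {B t : ℕ} {v : V} (h : ¬ (stateAt B N t v).Halted) :
    stateAt B N (t + 1) v = (layerStreaming B).receive (N.deg v) (stateAt B N t v)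
      ((layerStreaming B).incoming N ((layerStreaming B).run N t) v) := by
  classical
  have : (layerStreaming B).output ((layerStreaming B).run N t v) = _ := output_eq B (stateAt B N t v)
  rw [if_neg h] at this
  change (layerStreaming B).round N _ v = _
  rw [Algorithm.round, this]
  rfl

theorem sent_le {B : ℕ} (hdeg : ∀ v, N.deg v ≠ 0) (t : ℕ) (v : V) :
    (stateAt B N t v).sent ≤ (encodeList (stateAt B N t v).own).length := by
  induction t with
  | zero => simp [stateAt, Algorithm.run, layerStreaming, hdeg]
  | succ t ih =>
    by_cases h : (stateAt B N t v).Halted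
    · rwa [stateAt_succ_of_halted h]
    · rw [stateAt_succ_of_not_halted h]
      refine (min_le_right _ _).trans ?_
      obtain ⟨M, hM⟩ := prefix_extend (N.deg v) (stateAt B N t v).own fun i => decode
        (((layerStreaming B).receive (N.deg v) (stateAt B N t v)
          ((layerStreaming B).incoming N ((layerStreaming B).run N t) v) : NodeState).recv i)
      change _ ≤ (encodeList (Congest.extend _ _ _)).length
      erw [← hM]
      rw [encodeList_append, List.length_append]
      exact Nat.le_add_right _ _

theorem sent_succ {B : ℕ} (t : ℕ) (v : V) :
    (stateAt B N (t + 1) v).sent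
      = min ((stateAt B N t v).sent + B) (encodeList (stateAt B N t v).own).length := by
  by_cases h : (stateAt B N t v).Halted
  · rw [stateAt_succ_of_halted h, ← h.2]
    simp
  · rw [stateAt_succ_of_not_halted h]
    rfl

theorem own_prefix_succ (B t : ℕ) (v : V) :
    (stateAt B N t v).own <+: (stateAt B N (t + 1) v).own := by
  by_cases h : (stateAt B N t v).Halted
  · rw [stateAt_succ_of_halted h]
  · rw [stateAt_succ_of_not_halted h]
    exact prefix_extend _ _ _

/-- Sent bits stay valid because lists only grow at the end. A halted neighbour is silent, but it
has nothing left to send. -/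
theorem recv_succ {B : ℕ} (hdeg : ∀ v, N.deg v ≠ 0) (t : ℕ) (v : V)
    (h : ¬ (stateAt B N t v).Halted) (i : Fin (N.deg v)) :
    (stateAt B N (t + 1) v).recv i = (encodeList (stateAt B N (t + 1) (N.port v i)).own).take
      (stateAt B N (t + 1) (N.port v i)).sent := by
  induction t with
  | zero => exact step 0 h (by simp [stateAt, Algorithm.run, layerStreaming, hdeg])
  | succ t ih => exact step _ h (ih fun h0 => h (by rwa [stateAt_succ_of_halted h0]))
where
  step (t : ℕ) (h : ¬ (stateAt B N t v).Halted)
      (ih : (stateAt B N t v).recv i = (encodeList (stateAt B N t (N.port v i)).own).take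
        (stateAt B N t (N.port v i)).sent) :
      (stateAt B N (t + 1) v).recv i = (encodeList (stateAt B N (t + 1) (N.port v i)).own).take
        (stateAt B N (t + 1) (N.port v i)).sent := by
    have e : (stateAt B N (t + 1) v).recv i = (stateAt B N t v).recv i ++
        ((encodeList (stateAt B N t (N.port v i)).own).drop
          (stateAt B N t (N.port v i)).sent).take B := by
      rw [stateAt_succ_of_not_halted h]
      change (stateAt B N t v).recv i ++ (if h : (i : ℕ) < N.deg v then _ else _) = _
      rw [dif_pos i.2]
      congr 1
      exact val_outgoing B _ _ _
    rw [e, ih, sent_succ, ← List.take_add]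
    obtain ⟨M, hM⟩ := own_prefix_succ (N := N) B t (N.port v i)
    rw [← hM, encodeList_append, List.take_append_of_le_length (min_le_right _ _),
      ← List.take_eq_take_min]

theorem own_succ {B : ℕ} (hdeg : ∀ v, N.deg v ≠ 0) (t : ℕ) (v : V) :
    (stateAt B N (t + 1) v).own = Congest.extend (N.deg v) (stateAt B N t v).own
      fun i => knownAt B N (t + 1) (N.port v i) := by
  by_cases h : (stateAt B N t v).Halted
  · rw [stateAt_succ_of_halted h]
    -- The frozen buffers of a halted node are harmless, since an exhausted list is not extended.
    simp [Congest.extend, h.1]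
  · simp only [knownAt, ← recv_succ hdeg t v h]
    rw [stateAt_succ_of_not_halted h]
    rfl

theorem knownAt_prefix (B t : ℕ) (v : V) : knownAt B N t v <+: (stateAt B N t v).own :=
  decode_take_encodeList_prefix _ _

theorem knownAt_succ_prefix (B t : ℕ) (v : V) :
    knownAt B N (t + 1) v <+: (stateAt B N t v).own := by
  obtain ⟨M, hM⟩ := own_prefix_succ (N := N) B t v
  rw [knownAt, ← hM, encodeList_append, sent_succ,
    List.take_append_of_le_length (min_le_right _ _)]
  exact decode_take_encodeList_prefix _ _

theorem describes_own {B : ℕ} (hdeg : ∀ v, N.deg v ≠ 0) (t : ℕ) (v : V) :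
    Describes N v (stateAt B N t v).own := by
  induction t generalizing v with
  | zero => simpa [stateAt, Algorithm.run, layerStreaming, hdeg] using describes_init v
  | succ t ih =>
    rw [own_succ hdeg]
    exact (ih v).extend (fun i => ih _) fun i => knownAt_succ_prefix B t _

/-! ### Running time -/

section time

variable [Fintype V]

theorem known_bounds {B b : ℕ} (hdeg : ∀ v, N.deg v ≠ 0) (hb : 1 ≤ b)
    (hid : ∀ v, (encode (N.ident v + 1)).length ≤ b) {t d : ℕ} {w : V}
    (hd : (knownAt B N t w).count 0 ≤ d) :
    (stateAt B N t w).sent < ballLength N d w ∧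
      (stateAt B N t w).sent ≤ (encodeList (knownAt B N t w)).length + b := by
  have hD := describes_own (B := B) hdeg t w
  rcases decode_take_encodeList (stateAt B N t w).own (stateAt B N t w).sent with h | ⟨x, h, hlt⟩
  · change knownAt B N t w = _ at h
    have h1 := sent_le (B := B) hdeg t w
    have h2 := hD.length_lt (knownAt_prefix B t w) hd
    rw [h] at h2 ⊢
    omega
  · change knownAt B N t w ++ [x] <+: _ at h
    change _ < (encodeList (knownAt B N t w ++ [x])).length at hlt
    refine ⟨hlt.trans_le (hD.length_append_singleton_le h hd), ?_⟩
    rw [encodeList_append, List.length_append] at hlt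
    have : (encodeList [x]).length ≤ b := by
      by_cases hx : x = 0
      · simpa [encodeList, hx, length_encode] using hb
      · obtain ⟨j, -, hm⟩ := exists_mem_layer (h.subset (by simp)) hx
        obtain ⟨s, rfl, -⟩ := hD.sound _ _ hm
        simpa [encodeList] using hid s
    omega

/-- Pipelining: after an initial delay of `τ` rounds per layer, the layers `0, …, d` are sent at
full speed. -/
theorem min_le_sent {B b τ : ℕ} (hdeg : ∀ v, N.deg v ≠ 0) (hb : 1 ≤ b)
    (hid : ∀ v, (encode (N.ident v + 1)).length ≤ b) (hτ : 2 ≤ τ) (hBτ : b + B ≤ B * τ)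
    -- The `+ 1` admits the empty layer just beyond the farthest nodes, which is needed for halting.
    (d : ℕ) (v : V) (hv : ∃ s, d ≤ N.graph.dist v s + 1) (t : ℕ) :
    min (B * (t - d * τ)) (ballLength N d v) ≤ (stateAt B N t v).sent := by
  induction d generalizing v t with
  | zero =>
    induction t with
    | zero => simp
    | succ t ih =>
      -- Layer `0` is closed from the start, so its code can be sent without waiting.
      have := (describes_own (B := B) hdeg t v).ballLength_le (describes_own hdeg t v).pos
      rw [sent_succ]
      simp only [zero_mul, Nat.sub_zero, mul_add, mul_one] at ih ⊢
      omega
  | succ d ihd =>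
    obtain ⟨r, hr⟩ := hv
    have hr' : d ≤ N.graph.dist v r := by omega
    induction t with
    | zero => simp
    | succ t iht =>
      rw [sent_succ]
      rcases Nat.lt_or_ge t ((d + 1) * τ) with hlt | hge
      · rw [Nat.sub_eq_zero_of_le hlt]
        simp
      obtain ⟨x, rfl⟩ := Nat.exists_eq_add_of_le hge
      have e1 : (d + 1) * τ + x + 1 - (d + 1) * τ = x + 1 := by omega
      have e2 : (d + 1) * τ + x - (d + 1) * τ = x := by omega
      rw [e2] at iht
      rw [e1, mul_add, mul_one]
      suffices h : min (B * x + B) (ballLength N (d + 1) v)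
          ≤ (encodeList (stateAt B N ((d + 1) * τ + x) v).own).length by omega
      have hpos : (d + 1) * τ + x = d * τ + (τ - 1 + x) + 1 := by
        rw [add_mul]; omega
      rw [hpos]
      set t' := d * τ + (τ - 1 + x) with ht'
      have hself := ihd v ⟨r, by omega⟩ t'
      have e3 : t' - d * τ = x + 1 + (τ - 2) := by omega
      rw [e3, mul_add, mul_add, mul_one] at hself
      have hmono : (encodeList (stateAt B N t' v).own).length
          ≤ (encodeList (stateAt B N (t' + 1) v).own).length := by
        obtain ⟨M, hM⟩ := own_prefix_succ (N := N) B t' v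
        rw [← hM, encodeList_append, List.length_append]
        omega
      have hsent := sent_le (B := B) hdeg t' v
      -- If `v` is still sending its layers up to `d`, then `hself` gives `B * (x + 1)` bits already
      -- sent.
      by_cases hW : ballLength N d v ≤ (stateAt B N t' v).sent
      swap
      · omega
      have hD := describes_own (B := B) hdeg t' v
      have hcount := hD.lt_count hW hsent
      by_cases hall : ∀ i : Fin (N.deg v), d < (knownAt B N (t' + 1) (N.port v i)).count 0
      · have := (describes_own (B := B) hdeg (t' + 1) v).ballLength_le (d := d + 1) (by
          rw [own_succ hdeg]
          exact hD.lt_count_extend hcount hr' hall)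
        omega
      -- Neighbour `i` has sent at least `B * (x + τ)` bits, and the code of `v`'s list is at most
      -- `b` bits shorter than that; by `hBτ` at least `B * (x + 1)` remain.
      · push Not at hall
        obtain ⟨i, hi⟩ := hall
        obtain ⟨h1, h2⟩ := known_bounds hdeg hb hid hi
        have h3 := hD.length_le_extend hcount (fun i => describes_own (B := B) hdeg t' _)
          (fun i => knownAt_succ_prefix B t' _) hi
        rw [← own_succ hdeg] at h3
        have h4 := ihd (N.port v i) ⟨r, by
          have := N.dist_le_add_one (N.port v i).2 r
          omega⟩ (t' + 1)
        have e4 : t' + 1 - d * τ = x + τ := by omega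
        rw [e4, mul_add] at h4
        omega

theorem ballEntries_subset (d : ℕ) (v : V) :
    ballEntries N d v ⊆ Finset.univ.image fun s => N.ident s + 1 :=
  Finset.image_subset_image (Finset.filter_subset _ _)

theorem ballLength_le {b : ℕ} (hid : ∀ v, (encode (N.ident v + 1)).length ≤ b) (d : ℕ) (v : V) :
    ballLength N d v ≤ d + 1 + Fintype.card V * b := by
  have h1 : ∑ x ∈ ballEntries N d v, (encode x).length ≤ (ballEntries N d v).card * b := by
    refine Finset.sum_le_card_nsmul _ _ _ ?_
    intro x hx
    obtain ⟨s, -, rfl⟩ := Finset.mem_image.1 (ballEntries_subset d v hx)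
    exact hid s
  have h2 : (ballEntries N d v).card ≤ Fintype.card V :=
    (Finset.card_image_le.trans (Finset.card_filter_le _ _))
  have h3 := Nat.mul_le_mul_right b h2
  unfold ballLength
  omega

/-- The layer beyond the farthest nodes is closed and empty, and by `nonempty` no layer after it is
closed; so the bits sent cover the entire list. -/
theorem halted_of_ballLength_le {B : ℕ} (hdeg : ∀ v, N.deg v ≠ 0) {t : ℕ} {v s : V}
    (hs : ∀ r, N.graph.dist v r ≤ N.graph.dist v s)
    (h : ballLength N (N.graph.dist v s + 1) v ≤ (stateAt B N t v).sent) :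
    (stateAt B N t v).Halted := by
  have hD := describes_own (B := B) hdeg t v
  have hle := sent_le (B := B) hdeg t v
  have hlt := hD.lt_count h hle
  have hcount : (stateAt B N t v).own.count 0 = N.graph.dist v s + 2 := by
    by_contra hne
    obtain ⟨r, hr⟩ := hD.nonempty (N.graph.dist v s + 1) (by omega)
    have := hs r
    omega
  refine ⟨?_, le_antisymm hle ?_⟩
  · rw [Exhausted, hcount, List.eq_nil_iff_forall_not_mem]
    intro x hx
    obtain ⟨r, -, hr⟩ := hD.sound _ _ hx
    have := hs r
    omega
  · refine le_trans ?_ h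
    rw [length_encodeList hD.nodup, hcount, ballLength]
    have : entries (stateAt B N t v).own ⊆ ballEntries N (N.graph.dist v s + 1) v := by
      intro x hx
      obtain ⟨s', hs', hm⟩ := Finset.mem_image.1 (hD.entries_subset (List.prefix_refl _) le_rfl hx)
      refine Finset.mem_image.2 ⟨s', ?_, hm⟩
      have := hs s'
      simp
      omega
    have := Finset.sum_le_sum_of_subset (f := fun x => (encode x).length) this
    omega

theorem computesWithin {B b τ D T : ℕ} (hdeg : ∀ v, N.deg v ≠ 0) (hb : 1 ≤ b)
    (hid : ∀ v, (encode (N.ident v + 1)).length ≤ b) (hτ : 2 ≤ τ) (hBτ : b + B ≤ B * τ)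
    (hD : ∀ v s, N.graph.dist v s ≤ D)
    (hT : D + 2 + Fintype.card V * b ≤ B * (T - (D + 1) * τ)) :
    (layerStreaming B).ComputesWithin N (apsp N) T := by
  classical
  intro v
  obtain ⟨s, -, hs⟩ := Finset.exists_max_image Finset.univ (fun s => N.graph.dist v s)
    ⟨v, Finset.mem_univ v⟩
  have h1 := min_le_sent hdeg hb hid hτ hBτ (N.graph.dist v s + 1) v ⟨s, le_rfl⟩ T
  have h2 := ballLength_le hid (N.graph.dist v s + 1) v
  have h3 := hD v s
  have h4 : B * (T - (D + 1) * τ) ≤ B * (T - (N.graph.dist v s + 1) * τ) := by gcongr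
  have h5 := halted_of_ballLength_le (B := B) hdeg (t := T) (v := v) (s := s)
    (fun r => hs r (Finset.mem_univ r)) (by omega)
  have h6 := output_eq B (stateAt B N T v)
  rw [if_pos h5, (describes_own hdeg T v).table_eq h5.1] at h6
  exact h6

end time

/-! ### Asymptotics -/

/-- Since the coefficients are natural numbers, `p.eval n ≤ p.eval 1 * n ^ p.natDegree`, and `p.eval
1 < n ^ p.eval 1` for `n ≥ 2`. -/
theorem exists_size_le_log (p : Polynomial ℕ) :
    ∃ c : ℝ, 0 ≤ c ∧ ∀ n : ℕ, 2 ≤ n →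
      ((2 * (p.eval n + 1).size + 1 : ℕ) : ℝ) ≤ c * Real.log n := by
  obtain ⟨S, k, hS⟩ : ∃ S k : ℕ, ∀ n : ℕ, 2 ≤ n → p.eval n < n ^ S * n ^ k := by
    refine ⟨p.eval 1, p.natDegree, fun n hn => ?_⟩
    have h1 : p.eval n ≤ p.eval 1 * n ^ p.natDegree := by
      rw [Polynomial.eval_eq_sum_range, Polynomial.eval_eq_sum_range, Finset.sum_mul]
      refine Finset.sum_le_sum fun i hi => ?_
      rw [one_pow, mul_one]
      exact Nat.mul_le_mul_left _ (Nat.pow_le_pow_right (by omega)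
        (Nat.lt_succ_iff.1 (Finset.mem_range.1 hi)))
    exact h1.trans_lt (Nat.mul_lt_mul_of_pos_right (Nat.lt_pow_self (by omega)) (by positivity))
  have hl2 : 0 < Real.log 2 := Real.log_pos (by norm_num)
  refine ⟨(2 * (S + k) + 3) / Real.log 2, by positivity, fun n hn => ?_⟩
  have hln : Real.log 2 ≤ Real.log n := Real.log_le_log (by norm_num) (by exact_mod_cast hn)
  obtain ⟨m, hm⟩ : ∃ m, (p.eval n + 1).size = m + 1 :=
    Nat.exists_eq_succ_of_ne_zero (Nat.size_pos.2 (Nat.succ_pos _)).ne'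
  have h2 : 2 ^ m ≤ n ^ (S + k) := by
    have := Nat.lt_size.1 (show m < (p.eval n + 1).size by omega)
    have := hS n hn
    rw [pow_add]
    omega
  have h3 : (m : ℝ) * Real.log 2 ≤ (S + k) * Real.log n := by
    have := Real.log_le_log (by positivity) (show ((2 : ℝ) ^ m) ≤ (n : ℝ) ^ (S + k) by
      exact_mod_cast h2)
    rw [Real.log_pow, Real.log_pow] at this
    exact_mod_cast this
  rw [hm, div_mul_eq_mul_div, le_div_iff₀ hl2]
  push_cast
  nlinarith

theorem Network.deg_ne_zero [Nontrivial V] (N : Network V) (v : V) : N.deg v ≠ 0 := by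
  intro h
  obtain ⟨s, hs⟩ := exists_ne v
  obtain ⟨k, hk⟩ := Nat.exists_eq_succ_of_ne_zero
    (fun h0 => hs ((N.connected.dist_eq_zero_iff).1 h0).symm : N.graph.dist v s ≠ 0)
  obtain ⟨w, hw, -⟩ := N.exists_adj_dist hk
  obtain ⟨i, -⟩ := N.exists_port hw
  exact (Fin.cast h i).elim0

theorem computesWithin_zero [Fintype V] [Subsingleton V] (B : ℕ) :
    (layerStreaming B).ComputesWithin N (apsp N) 0 := by
  intro v
  have hdeg : N.deg v = 0 := by
    by_contra h
    exact (N.port v ⟨0, Nat.pos_of_ne_zero h⟩).2.ne (Subsingleton.elim _ _)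
  have hs : stateAt B N 0 v = ⟨[N.ident v + 1, 0, 0],
      (encodeList [N.ident v + 1, 0, 0]).length, fun _ => []⟩ := by
    simp [stateAt, Algorithm.run, layerStreaming, hdeg]
  have h : (layerStreaming B).output (stateAt B N 0 v) = some (table [N.ident v + 1, 0, 0]) := by
    classical
    rw [output_eq, hs, if_pos ⟨by simp [Exhausted, layer], rfl⟩]
  refine h.trans (congrArg some ?_)
  have : (Finset.univ : Finset V) = {v} := by
    ext w
    simp [Subsingleton.elim w v]
  rw [apsp, this]
  simp [table, layer, Finset.range_add_one]

theorem Network.dist_lt_card [Fintype V] (N : Network V) (v w : V) :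
    N.graph.dist v w < Fintype.card V := by
  obtain ⟨p, hp, hl⟩ := N.connected.exists_path_of_dist v w
  exact hl ▸ hp.length_lt

theorem exists_rounds [Fintype V] [Nontrivial V] {B b : ℕ} (hB : 1 ≤ B) (hb : 1 ≤ b)
    (hid : ∀ v, (encode (N.ident v + 1)).length ≤ b) :
    ∃ T : ℕ, (T : ℝ) ≤ 5 * N.graph.diam + 4 * (Fintype.card V * b / B) ∧
      (layerStreaming B).ComputesWithin N (apsp N) T := by
  obtain ⟨v₀⟩ := N.connected.nonempty
  have htop : N.graph.ediam ≠ ⊤ := SimpleGraph.connected_iff_ediam_ne_top.1 N.connected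
  have hD1 : 1 ≤ N.graph.diam :=
    Nat.one_le_iff_ne_zero.2 (SimpleGraph.diam_ne_zero_of_ediam_ne_top htop)
  have hDn : N.graph.diam + 1 ≤ Fintype.card V := by
    obtain ⟨v, w, h⟩ := N.graph.exists_dist_eq_diam
    exact h ▸ N.dist_lt_card v w
  set D := N.graph.diam
  set n := Fintype.card V
  -- A delay for each step up to layer `D + 1`, then the time to send at most `D + 2 + n * b` bits.
  refine ⟨(D + 1) * (b / B + 2) + ((D + 2 + n * b) / B + 1), ?_,
    computesWithin (τ := b / B + 2) (D := D) N.deg_ne_zero hb hid (Nat.le_add_left _ _) ?_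
      (fun v s => SimpleGraph.dist_le_diam htop) ?_⟩
  · have h1 : ((b / B : ℕ) : ℝ) ≤ b / B := Nat.cast_div_le
    have h2 : (((D + 2 + n * b) / B : ℕ) : ℝ) ≤ ((D + 2 + n * b : ℕ) : ℝ) / B := Nat.cast_div_le
    have hB' : (0 : ℝ) < B := by exact_mod_cast hB
    have hDn' : (D : ℝ) + 1 ≤ n := by exact_mod_cast hDn
    have hD1' : (1 : ℝ) ≤ D := by exact_mod_cast hD1
    have hb' : (1 : ℝ) ≤ b := by exact_mod_cast hb
    -- The delays caused by unfinished words are affordable because `D + 1 ≤ n`.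
    have h3 : ((D : ℝ) + 1) * (b / B : ℕ) ≤ n * b / B := by
      rw [mul_div_assoc]
      exact mul_le_mul hDn' h1 (by positivity) (by positivity)
    have h4 : ((D + 2 + n * b : ℕ) : ℝ) / B ≤ 3 * (n * b / B) := by
      rw [← mul_div_assoc]
      refine div_le_div_of_nonneg_right ?_ hB'.le
      push_cast
      nlinarith
    push_cast at h2 h4 ⊢
    nlinarith
  · have := Nat.lt_mul_div_succ b (show 0 < B by omega)
    rw [mul_add, mul_one] at this
    rw [mul_add, mul_two]
    omega
  · rw [Nat.add_sub_cancel_left]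
    exact (Nat.lt_mul_div_succ _ (by omega)).le

end Congest

theorem theorem1 :
    ∃ A : (B : ℕ) → Congest.Algorithm B (Finset (ℕ × ℕ)),
      ∀ p : Polynomial ℕ, ∃ C : ℝ,
        ∀ (B : ℕ), 1 ≤ B →
        ∀ (V : Type*) [Fintype V] (N : Congest.Network V),
          (∀ v, N.ident v ≤ p.eval (Fintype.card V)) →
          ∃ T : ℕ,
            (T : ℝ) ≤ C * ((N.graph.diam : ℝ) +
              (Fintype.card V : ℝ) * Real.log (Fintype.card V) / (B : ℝ)) ∧
            (A B).ComputesWithin N (Congest.apsp N) T := by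
  refine ⟨Congest.layerStreaming, fun p => ?_⟩
  obtain ⟨c, hc, hlog⟩ := Congest.exists_size_le_log p
  refine ⟨5 + 4 * c, fun B hB V _ N hN => ?_⟩
  have hX : 0 ≤ (Fintype.card V : ℝ) * Real.log (Fintype.card V) / (B : ℝ) := by positivity
  rcases subsingleton_or_nontrivial V with hV | hV
  · exact ⟨0, by push_cast; positivity, Congest.computesWithin_zero B⟩
  obtain ⟨T, hT, hcomp⟩ := Congest.exists_rounds (N := N) hB
    (b := 2 * (p.eval (Fintype.card V) + 1).size + 1) (by omega) (fun v => by
      rw [Congest.length_encode]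
      have := Nat.size_le_size (Nat.succ_le_succ (hN v))
      simp only [Nat.succ_eq_add_one] at this
      omega)
  refine ⟨T, hT.trans ?_, hcomp⟩
  have h1 := hlog _ (Fintype.one_lt_card (α := V))
  have h2 : (Fintype.card V : ℝ) * ((2 * (p.eval (Fintype.card V) + 1).size + 1 : ℕ) : ℝ) / B
      ≤ c * ((Fintype.card V : ℝ) * Real.log (Fintype.card V) / (B : ℝ)) := by
    rw [← mul_div_assoc]
    refine div_le_div_of_nonneg_right ?_ (by positivity)
    calc _ ≤ (Fintype.card V : ℝ) * (c * Real.log (Fintype.card V)) := by gcongr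
      _ = _ := by ring
  have h3 : 0 ≤ c * (N.graph.diam : ℝ) := by positivity
  linarith
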